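/- Let $E$ be a (real) Banach lattice, $Y$ a (real) Banach space, $T:E\to Y$ a bounded linear operator and $\mathcal S\subset E$ a norm bounded subset. Write $E^+=\{u\in E: u\ge 0\}$, let $(E')^+$ be the set of positive functionals in the norm dual $E'$ of $E$, and let $\mathrm{sol}(\mathcal S)=\{x\in E: \exists\, y\in\mathcal S,\ |x|\le |y|\}$ be the solid hull of $\mathcal S$. A net $(x_\alpha)$ in $E$ is called uaw-null (unbounded absolutely weakly convergent to $0$) if, for every $u\in E^+$, the net $(|x_\alpha|\wedge u)$ converges weakly to $0$. The operator $T$ is called $\mathcal S$-L-weakly compact if $\|T(x_n)\|\to 0$ for every uaw-null sequence $(x_n)$ contained in $\mathrm{sol}(\mathcal S)$. Then the following statements are equivalent: 1. $T$ is $\mathcal S$-L-weakly compact. 2. For each $\varepsilon>0$ there exist $g\in (E')^+$ and $u\in E^+$ such that $\|T(x)\|\le g(|x|\wedge u)+\varepsilon$ for all $x\in\mathrm{sol}(\mathcal S)$. 3. For every uaw-null net $(x_\alpha)$ contained in $\mathrm{sol}(\mathcal S)$, $\|T(x_\alpha)\|\to 0$. -/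

import Mathlib

open Filter Topology LatticeOrderedAddCommGroup

section

variable {E : Type*} [NormedAddCommGroup E] [NormedSpace ℝ E] [Lattice E]

/-- Unbounded absolute weak convergence of a family `x` along a filter `l` to the point `a`:
for every `u ≥ 0`, `|x i - a| ⊓ u` converges to `0` in the weak topology of `E`.
Nets and sequences are the case `l = atTop`. -/
def UawTendsto {ι : Type*} (x : ι → E) (l : Filter ι) (a : E) : Prop :=
  ∀ u : E, 0 ≤ u → Tendsto (fun i => toWeakSpace ℝ E (|x i - a| ⊓ u)) l (𝓝 0)

/-- `T` is `S`-L-weakly compact: it maps every uaw-null sequence lying in the solid hull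
`solidClosure S = {y | ∃ x ∈ S, |y| ≤ |x|}` to a norm-null sequence. -/
def IsLWeaklyCompactOn {Y : Type*} [NormedAddCommGroup Y] [NormedSpace ℝ Y]
    (S : Set E) (T : E →L[ℝ] Y) : Prop :=
  ∀ x : ℕ → E, (∀ n, x n ∈ solidClosure S) → UawTendsto x atTop 0 →
    Tendsto (fun n => T (x n)) atTop (𝓝 0)

end

/-! ### Disjointness and truncation in vector lattices. -/

section VectorLattice

variable {E : Type*} [AddCommGroup E] [Lattice E] [IsOrderedAddMonoid E]

/-! Only 1 → 2 is hard. Put `ρ_φ x = sup {‖φ y‖ : |y| ≤ x}` (`orderIntervalNorm`); for a functional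
`f` this is `|f| x`, additive on the cone. Disjoint sequences are uaw-null, so 1 forces `ρ_T (z n) →
0` along disjoint positive sequences in the solid hull. This is used twice, by contradiction. Large
elements: if no `u` makes `ρ_T (|x| - u)⁺` uniformly small, truncating badly behaved elements yields
a disjoint sequence on which `ρ_T` stays large (`exists_orderIntervalNorm_posPart_sub_le`). Elements
of `[0, u]`: if no positive `g` dominates `ρ_T` up to `ε` there, `NotDominatedOn.exists_split`
splits off a piece with large `ρ_T`, leaving a disjoint remainder on which domination still fails.
Iteration gives a forbidden sequence. Subadditivity of `ρ_T` on `|x| = (|x| - u)⁺ + |x| ⊓ u`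
combines the two. -/

theorem exists_abs_le_add_eq {a b y : E} (ha : 0 ≤ a) (hb : 0 ≤ b) (h : |y| ≤ a + b) :
    ∃ y₁ y₂, y = y₁ + y₂ ∧ |y₁| ≤ a ∧ |y₂| ≤ b := by
  have h1 : y ≤ a + b := (le_abs_self y).trans h
  have h2 : -y ≤ a + b := (neg_le_abs y).trans h
  have haa : -a ≤ a := (neg_nonpos.2 ha).trans ha
  -- Truncate `y` to `[-a, a]`; the remainder is what `b` must absorb.
  refine ⟨(y ⊓ a) ⊔ -a, y - ((y ⊓ a) ⊔ -a), by abel, ?_, ?_⟩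
  · rw [abs_le']
    exact ⟨sup_le inf_le_right haa, neg_le.1 le_sup_right⟩
  · rw [abs_le']
    constructor
    · have h3 : y - b ≤ y ⊓ a := le_inf (sub_le_self _ hb) (sub_le_iff_le_add.2 h1)
      have h4 : y - b ≤ (y ⊓ a) ⊔ -a := h3.trans le_sup_left
      exact sub_le_comm.1 h4
    · rw [neg_sub, sub_le_iff_le_add]
      refine sup_le (inf_le_left.trans (le_add_of_nonneg_left hb)) ?_
      have := neg_le_neg h2
      rw [neg_neg] at this
      calc -a = -(a + b) + b := by abel
        _ ≤ y + b := by gcongr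
        _ = b + y := add_comm _ _

theorem sub_posPart_sub_eq_inf (a b : E) : a - (a - b)⁺ = a ⊓ b :=
  (inf_eq_sub_posPart_sub a b).symm

theorem posPart_sub_le_self {a b : E} (ha : 0 ≤ a) (hb : 0 ≤ b) : (a - b)⁺ ≤ a :=
  sup_le (sub_le_self _ hb) ha

theorem inf_add_eq_zero {a b c : E} (ha : 0 ≤ a) (hb : 0 ≤ b) (hc : 0 ≤ c)
    (hac : a ⊓ c = 0) (hbc : b ⊓ c = 0) : (a + b) ⊓ c = 0 := by
  refine le_antisymm ?_ (le_inf (add_nonneg ha hb) hc)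
  have h1 : (a + b) ⊓ c - a ≤ b ⊓ c :=
    le_inf (sub_le_iff_le_add'.2 inf_le_left) ((sub_le_self _ ha).trans inf_le_right)
  rw [hbc, sub_nonpos] at h1
  exact (le_inf h1 inf_le_right).trans hac.le

theorem sum_inf_eq_zero {ι : Type*} (s : Finset ι) {b : ι → E} {c : E} (hb : ∀ i ∈ s, 0 ≤ b i)
    (hc : 0 ≤ c) (h : ∀ i ∈ s, b i ⊓ c = 0) : (∑ i ∈ s, b i) ⊓ c = 0 := by
  classical
  induction s using Finset.induction_on with
  | empty => simpa using hc
  | insert i s hi ih =>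
    rw [Finset.sum_insert hi]
    simp only [Finset.mem_insert, forall_eq_or_imp] at hb h
    exact inf_add_eq_zero hb.1 (Finset.sum_nonneg hb.2) hc h.1 (ih hb.2 h.2)

theorem sum_le_of_pairwise_inf_eq_zero {ι : Type*} (s : Finset ι) {b : ι → E} {x : E}
    (hb : ∀ i ∈ s, 0 ≤ b i) (hx : 0 ≤ x) (hbx : ∀ i ∈ s, b i ≤ x)
    (h : ∀ i ∈ s, ∀ j ∈ s, i ≠ j → b i ⊓ b j = 0) : ∑ i ∈ s, b i ≤ x := by
  classical
  induction s using Finset.induction_on with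
  | empty => simpa using hx
  | insert i s hi ih =>
    rw [Finset.sum_insert hi]
    have hs := ih (fun j hj => hb j (by simp [hj])) (fun j hj => hbx j (by simp [hj]))
      (fun j hj k hk => h j (by simp [hj]) k (by simp [hk]))
    have h0 : (∑ j ∈ s, b j) ⊓ b i = 0 :=
      sum_inf_eq_zero s (fun j hj => hb j (by simp [hj])) (hb i (by simp))
        (fun j hj => h j (by simp [hj]) i (by simp) (by rintro rfl; exact hi hj))
    rw [add_comm, ← inf_add_sup, h0, zero_add]
    exact sup_le hs (hbx i (by simp))

theorem inf_eq_zero_mono {E : Type*} [Lattice E] [Zero E] {a b c d : E}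
    (hc : 0 ≤ c) (hd : 0 ≤ d) (hca : c ≤ a) (hdb : d ≤ b)
    (h : a ⊓ b = 0) : c ⊓ d = 0 :=
  le_antisymm ((inf_le_inf hca hdb).trans h.le) (le_inf hc hd)

variable [Module ℝ E] [IsOrderedModule ℝ E]

theorem smul_inf_smul_eq_zero {a b : E} (ha : 0 ≤ a) (hb : 0 ≤ b) (h : a ⊓ b = 0) {c d : ℝ}
    (hc : 0 ≤ c) (hd : 0 ≤ d) : (c • a) ⊓ (d • b) = 0 := by
  have hM : 0 < c + d + 1 := by positivity
  refine le_antisymm ?_ (le_inf (smul_nonneg hc ha) (smul_nonneg hd hb))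
  have h1 : (c • a) ⊓ (d • b) ≤ (c + d + 1) • a :=
    inf_le_left.trans (smul_le_smul_of_nonneg_right (by linarith) ha)
  have h2 : (c • a) ⊓ (d • b) ≤ (c + d + 1) • b :=
    inf_le_right.trans (smul_le_smul_of_nonneg_right (by linarith) hb)
  have h3 : (c + d + 1)⁻¹ • ((c • a) ⊓ (d • b)) ≤ a ⊓ b := by
    refine le_inf ?_ ?_
    · simpa [smul_smul, inv_mul_cancel₀ hM.ne'] using
        smul_le_smul_of_nonneg_left h1 (inv_nonneg.2 hM.le)
    · simpa [smul_smul, inv_mul_cancel₀ hM.ne'] using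
        smul_le_smul_of_nonneg_left h2 (inv_nonneg.2 hM.le)
  rw [h] at h3
  simpa [smul_smul, mul_inv_cancel₀ hM.ne'] using smul_le_smul_of_nonneg_left h3 hM.le

/-- The source of all disjointness below: the second factor is at most `d • (a - c • b)⁻`, and
positive and negative parts are disjoint. -/
theorem posPart_sub_smul_inf_eq_zero {a b : E} (hb : 0 ≤ b) {c d : ℝ} (hd : 0 ≤ d)
    (hcd : 1 ≤ c * d) : (a - c • b)⁺ ⊓ (b - d • a)⁺ = 0 := by
  have h1 : b - d • a ≤ d • (a - c • b)⁻ := by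
    calc b - d • a ≤ (c * d) • b - d • a := by
          gcongr
          simpa using smul_le_smul_of_nonneg_right hcd hb
      _ = d • (-(a - c • b)) := by
          rw [smul_neg, smul_sub, smul_smul, mul_comm d c]; abel
      _ ≤ d • (a - c • b)⁻ := smul_le_smul_of_nonneg_left (neg_le_negPart _) hd
  have h2 := smul_inf_smul_eq_zero (posPart_nonneg (a - c • b)) (negPart_nonneg (a - c • b))
    (posPart_inf_negPart_eq_zero _) zero_le_one hd
  rw [one_smul] at h2
  exact inf_eq_zero_mono (posPart_nonneg _) (posPart_nonneg _) le_rfl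
    (sup_le h1 (smul_nonneg hd (negPart_nonneg _))) h2

end VectorLattice

/-! ### The seminorm `ρ_φ` and the modulus of a functional. -/

section SupNorm

variable {E : Type*} [NormedAddCommGroup E] [NormedSpace ℝ E] [Lattice E]
  [IsOrderedAddMonoid E] [HasSolidNorm E]
  {Y : Type*} [NormedAddCommGroup Y] [NormedSpace ℝ Y]

/-- The supremum of `‖φ y‖` over the order interval `|y| ≤ x`. -/
noncomputable def orderIntervalNorm (φ : E →L[ℝ] Y) (x : E) : ℝ :=
  sSup ((fun y => ‖φ y‖) '' {y | |y| ≤ x})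

theorem norm_apply_le_of_abs_le {E : Type*} [NormedAddCommGroup E] [NormedSpace ℝ E] [Lattice E]
    [HasSolidNorm E] (φ : E →L[ℝ] Y) {x y : E} (h : |y| ≤ x) :
    ‖φ y‖ ≤ ‖φ‖ * ‖x‖ :=
  (φ.le_opNorm y).trans <| mul_le_mul_of_nonneg_left
    (norm_le_norm_of_abs_le_abs (h.trans (le_abs_self x))) (norm_nonneg _)

theorem norm_apply_le_orderIntervalNorm {E : Type*} [NormedAddCommGroup E] [NormedSpace ℝ E]
    [Lattice E] [HasSolidNorm E] (φ : E →L[ℝ] Y) {x y : E} (h : |y| ≤ x) :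
    ‖φ y‖ ≤ orderIntervalNorm φ x := by
  refine le_csSup ⟨‖φ‖ * ‖x‖, ?_⟩ ⟨y, h, rfl⟩
  rintro _ ⟨z, hz, rfl⟩
  exact norm_apply_le_of_abs_le φ hz

theorem orderIntervalNorm_le {E : Type*} [NormedAddCommGroup E] [NormedSpace ℝ E] [Lattice E]
    [IsOrderedAddMonoid E] (φ : E →L[ℝ] Y) {x : E} (hx : 0 ≤ x) {C : ℝ}
    (h : ∀ y, |y| ≤ x → ‖φ y‖ ≤ C) : orderIntervalNorm φ x ≤ C := by
  refine csSup_le ⟨_, 0, by simpa using hx, rfl⟩ ?_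
  rintro _ ⟨z, hz, rfl⟩
  exact h z hz

theorem exists_lt_norm_apply {E : Type*} [NormedAddCommGroup E] [NormedSpace ℝ E] [Lattice E]
    [IsOrderedAddMonoid E] (φ : E →L[ℝ] Y) {x : E} (hx : 0 ≤ x) {C : ℝ}
    (h : C < orderIntervalNorm φ x) : ∃ y, |y| ≤ x ∧ C < ‖φ y‖ := by
  by_contra! H
  exact h.not_ge (orderIntervalNorm_le φ hx H)

theorem orderIntervalNorm_nonneg (φ : E →L[ℝ] Y) {x : E} (hx : 0 ≤ x) :
    0 ≤ orderIntervalNorm φ x :=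
  (norm_nonneg _).trans (norm_apply_le_orderIntervalNorm φ (y := 0) (by simpa using hx))

theorem orderIntervalNorm_le_opNorm (φ : E →L[ℝ] Y) {x : E} (hx : 0 ≤ x) :
    orderIntervalNorm φ x ≤ ‖φ‖ * ‖x‖ :=
  orderIntervalNorm_le φ hx fun _ => norm_apply_le_of_abs_le φ

theorem orderIntervalNorm_mono (φ : E →L[ℝ] Y) {x x' : E} (hx : 0 ≤ x) (h : x ≤ x') :
    orderIntervalNorm φ x ≤ orderIntervalNorm φ x' :=
  orderIntervalNorm_le φ hx fun _ hy => norm_apply_le_orderIntervalNorm φ (hy.trans h)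

theorem orderIntervalNorm_add_le (φ : E →L[ℝ] Y) {a b : E} (ha : 0 ≤ a) (hb : 0 ≤ b) :
    orderIntervalNorm φ (a + b) ≤ orderIntervalNorm φ a + orderIntervalNorm φ b := by
  refine orderIntervalNorm_le φ (add_nonneg ha hb) fun y hy => ?_
  obtain ⟨y₁, y₂, rfl, h1, h2⟩ := exists_abs_le_add_eq ha hb hy
  rw [map_add]
  exact (norm_add_le _ _).trans (add_le_add (norm_apply_le_orderIntervalNorm φ h1)
    (norm_apply_le_orderIntervalNorm φ h2))

theorem orderIntervalNorm_posPart_sub_ge (φ : E →L[ℝ] Y) {a b : E} (ha : 0 ≤ a) (hb : 0 ≤ b) :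
    orderIntervalNorm φ a - ‖φ‖ * ‖b‖ ≤ orderIntervalNorm φ (a - b)⁺ := by
  have h1 : a ≤ (a - b)⁺ + b := sub_le_iff_le_add.1 (le_posPart _)
  have h2 := (orderIntervalNorm_mono φ ha h1).trans
    (orderIntervalNorm_add_le φ (posPart_nonneg _) hb)
  linarith [orderIntervalNorm_le_opNorm φ hb]

/-- Superadditivity is special to scalar values: `|f y| + |f z|` is `|f (y + z)|` or `|f (y - z)|`,
according to signs. -/
theorem orderIntervalNorm_add (f : StrongDual ℝ E) {a b : E} (ha : 0 ≤ a) (hb : 0 ≤ b) :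
    orderIntervalNorm f (a + b) = orderIntervalNorm f a + orderIntervalNorm f b := by
  refine le_antisymm (orderIntervalNorm_add_le f ha hb) ?_
  have key : ∀ y z, |y| ≤ a → |z| ≤ b → ‖f y‖ + ‖f z‖ ≤ orderIntervalNorm f (a + b) := by
    intro y z hy hz
    have h1 : |y + z| ≤ a + b := (abs_add_le y z).trans (add_le_add hy hz)
    have h2 : |y - z| ≤ a + b := by
      rw [sub_eq_add_neg]
      exact (abs_add_le y (-z)).trans (add_le_add hy (by rwa [abs_neg]))
    have h3 := norm_apply_le_orderIntervalNorm f h1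
    have h4 := norm_apply_le_orderIntervalNorm f h2
    rw [map_add, Real.norm_eq_abs] at h3
    rw [map_sub, Real.norm_eq_abs] at h4
    rw [Real.norm_eq_abs, Real.norm_eq_abs]
    rcases abs_cases (f y) with ⟨e1, _⟩ | ⟨e1, _⟩ <;>
      rcases abs_cases (f z) with ⟨e2, _⟩ | ⟨e2, _⟩ <;>
      rw [e1, e2] <;> linarith [le_abs_self (f y + f z), neg_le_abs (f y + f z),
        le_abs_self (f y - f z), neg_le_abs (f y - f z)]
  have h5 : orderIntervalNorm f a ≤ orderIntervalNorm f (a + b) - orderIntervalNorm f b := by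
    refine orderIntervalNorm_le f ha fun y hy => ?_
    have h6 : orderIntervalNorm f b ≤ orderIntervalNorm f (a + b) - ‖f y‖ :=
      orderIntervalNorm_le f hb fun z hz => by linarith [key y z hy hz]
    linarith
  linarith

/-- The modulus of a bounded functional on a normed lattice. -/
theorem exists_dual_eq_orderIntervalNorm (f : StrongDual ℝ E) :
    ∃ g : StrongDual ℝ E, ∀ x, 0 ≤ x → g x = orderIntervalNorm f x := by
  have h0 : orderIntervalNorm f 0 = 0 :=
    le_antisymm ((orderIntervalNorm_le_opNorm f le_rfl).trans (by simp))
      (orderIntervalNorm_nonneg f le_rfl)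
  let g : E →+ ℝ := AddMonoidHom.mk'
    (fun x => orderIntervalNorm f x⁺ - orderIntervalNorm f x⁻) (by
      intro a b
      have h : (a + b)⁺ + (a⁻ + b⁻) = (a + b)⁻ + (a⁺ + b⁺) := by
        have h1 := posPart_sub_negPart (a + b)
        have h2 := posPart_sub_negPart a
        have h3 := posPart_sub_negPart b
        have h4 : (a + b)⁺ - (a + b)⁻ = (a⁺ - a⁻) + (b⁺ - b⁻) := by rw [h1, h2, h3]
        have h5 : (a + b)⁺ = (a⁺ - a⁻) + (b⁺ - b⁻) + (a + b)⁻ := by rw [← h4]; abel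
        rw [h5]; abel
      have h' := congrArg (orderIntervalNorm f) h
      have pa := posPart_nonneg a
      have pb := posPart_nonneg b
      have na := negPart_nonneg a
      have nb := negPart_nonneg b
      rw [orderIntervalNorm_add f (posPart_nonneg _) (add_nonneg na nb),
        orderIntervalNorm_add f (negPart_nonneg _) (add_nonneg pa pb),
        orderIntervalNorm_add f na nb, orderIntervalNorm_add f pa pb] at h'
      linarith)
  have hg : Continuous g := by
    refine AddMonoidHomClass.continuous_of_bound g (‖f‖) fun x => ?_
    have h1 : |x⁺| ≤ |x| := by
      rw [abs_of_nonneg (posPart_nonneg x), ← posPart_add_negPart]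
      exact le_add_of_nonneg_right (negPart_nonneg x)
    have h2 : |x⁻| ≤ |x| := by
      rw [abs_of_nonneg (negPart_nonneg x), ← posPart_add_negPart]
      exact le_add_of_nonneg_left (posPart_nonneg x)
    have h3 := (orderIntervalNorm_le_opNorm f (posPart_nonneg x)).trans
      (mul_le_mul_of_nonneg_left (norm_le_norm_of_abs_le_abs h1) (norm_nonneg f))
    have h4 := (orderIntervalNorm_le_opNorm f (negPart_nonneg x)).trans
      (mul_le_mul_of_nonneg_left (norm_le_norm_of_abs_le_abs h2) (norm_nonneg f))
    have h5 := orderIntervalNorm_nonneg f (posPart_nonneg x)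
    have h6 := orderIntervalNorm_nonneg f (negPart_nonneg x)
    change |orderIntervalNorm f x⁺ - orderIntervalNorm f x⁻| ≤ _
    rw [abs_le]
    constructor <;> linarith
  refine ⟨g.toRealLinearMap hg, fun x hx => ?_⟩
  change orderIntervalNorm f x⁺ - orderIntervalNorm f x⁻ = _
  rw [posPart_of_nonneg hx, negPart_of_nonneg hx, h0, sub_zero]

end SupNorm

/-! ### Disjoint sequences and the truncation level `u`. -/

section Disjoint

variable {E : Type*} [NormedAddCommGroup E] [NormedSpace ℝ E] [Lattice E]
  [IsOrderedAddMonoid E] [HasSolidNorm E]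

theorem tendsto_toWeakSpace_zero_iff {E : Type*} [NormedAddCommGroup E] [NormedSpace ℝ E]
    {ι : Type*} {l : Filter ι} {x : ι → E} :
    Tendsto (fun i => toWeakSpace ℝ E (x i)) l (𝓝 0) ↔
      ∀ f : StrongDual ℝ E, Tendsto (fun i => f (x i)) l (𝓝 0) := by
  have hind : IsInducing
      (fun (x : WeakSpace ℝ E) (f : StrongDual ℝ E) => (topDualPairing ℝ E).flip x f) := ⟨rfl⟩
  rw [hind.tendsto_nhds_iff, tendsto_pi_nhds]
  refine forall_congr' fun f => ?_
  have h0 : (topDualPairing ℝ E).flip (0 : WeakSpace ℝ E) f = 0 := map_zero f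
  rw [h0]
  rfl

theorem mem_solidClosure_of_abs_le {E : Type*} [AddCommGroup E] [Lattice E] {S : Set E} {x y : E}
    (hx : x ∈ solidClosure S) (h : |y| ≤ |x|) : y ∈ solidClosure S :=
  isSolid_solidClosure S hx h

theorem mem_solidClosure_of_nonneg_of_le {E : Type*} [AddCommGroup E] [Lattice E]
    [IsOrderedAddMonoid E] {S : Set E} {x y : E} (hx : x ∈ solidClosure S)
    (hy : 0 ≤ y) (h : y ≤ x) : y ∈ solidClosure S :=
  mem_solidClosure_of_abs_le hx (by rwa [abs_of_nonneg hy, abs_of_nonneg (hy.trans h)])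

theorem sum_orderIntervalNorm_le (f : StrongDual ℝ E) {ι : Type*} (s : Finset ι) {b : ι → E}
    {x : E} (hb : ∀ i ∈ s, 0 ≤ b i) (hx : 0 ≤ x) (hbx : ∀ i ∈ s, b i ≤ x)
    (h : ∀ i ∈ s, ∀ j ∈ s, i ≠ j → b i ⊓ b j = 0) :
    ∑ i ∈ s, orderIntervalNorm f (b i) ≤ orderIntervalNorm f x := by
  obtain ⟨g, hg⟩ := exists_dual_eq_orderIntervalNorm f
  calc ∑ i ∈ s, orderIntervalNorm f (b i) = ∑ i ∈ s, g (b i) :=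
        Finset.sum_congr rfl fun i hi => (hg _ (hb i hi)).symm
    _ = g (∑ i ∈ s, b i) := (map_sum g _ _).symm
    _ = orderIntervalNorm f (∑ i ∈ s, b i) := hg _ (Finset.sum_nonneg hb)
    _ ≤ orderIntervalNorm f x := orderIntervalNorm_mono f (Finset.sum_nonneg hb)
        (sum_le_of_pairwise_inf_eq_zero s hb hx hbx h)

/-- The pieces `|x i| ⊓ u` are disjoint and below `u`, so their `|f|`-values have partial sums at
most `|f| u` and tend to zero. -/
theorem uawTendsto_zero_of_pairwise_disjoint {x : ℕ → E}
    (h : ∀ i j, i ≠ j → |x i| ⊓ |x j| = 0) : UawTendsto x atTop 0 := by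
  intro u hu
  rw [tendsto_toWeakSpace_zero_iff]
  intro f
  have hb : ∀ i, 0 ≤ |x i - 0| ⊓ u := fun i => le_inf (abs_nonneg _) hu
  have hs : Summable fun i => orderIntervalNorm f (|x i - 0| ⊓ u) := by
    refine summable_of_sum_le (c := orderIntervalNorm f u)
      (fun i => orderIntervalNorm_nonneg f (hb i)) fun s => ?_
    refine sum_orderIntervalNorm_le f s (fun i _ => hb i) hu (fun i _ => inf_le_right) ?_
    intro i _ j _ hij
    exact inf_eq_zero_mono (hb i) (hb j) (inf_le_left.trans (by rw [sub_zero]))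
      (inf_le_left.trans (by rw [sub_zero])) (h i j hij)
  refine squeeze_zero_norm (fun i => ?_) hs.tendsto_atTop_zero
  exact norm_apply_le_orderIntervalNorm f (abs_of_nonneg (hb i)).le

variable {Y : Type*} [NormedAddCommGroup Y] [NormedSpace ℝ Y]

theorem IsLWeaklyCompactOn.tendsto_orderIntervalNorm {S : Set E} {T : E →L[ℝ] Y}
    (hT : IsLWeaklyCompactOn S T) {z : ℕ → E} (hz : ∀ n, 0 ≤ z n)
    (hzS : ∀ n, z n ∈ solidClosure S) (hd : ∀ i j, i < j → z i ⊓ z j = 0) :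
    Tendsto (fun n => orderIntervalNorm T (z n)) atTop (𝓝 0) := by
  -- The supremum need not be attained; the factor 2 leaves room for a near-maximizer.
  have hy : ∀ n, ∃ y, |y| ≤ z n ∧ orderIntervalNorm T (z n) ≤ 2 * ‖T y‖ := by
    intro n
    rcases (orderIntervalNorm_nonneg T (hz n)).eq_or_lt with h0 | h0
    · exact ⟨0, by simpa using hz n, by simp [← h0]⟩
    · obtain ⟨y, h1, h2⟩ := exists_lt_norm_apply T (hz n) (half_lt_self h0)
      exact ⟨y, h1, by linarith⟩
  choose y hyz hyT using hy
  have hd' : ∀ i j, i ≠ j → z i ⊓ z j = 0 := fun i j hij => by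
    rcases hij.lt_or_gt with h | h
    · exact hd i j h
    · rw [inf_comm]; exact hd j i h
  have h1 := hT y
    (fun n => mem_solidClosure_of_abs_le (hzS n) ((hyz n).trans (le_abs_self _)))
    (uawTendsto_zero_of_pairwise_disjoint fun i j hij =>
      inf_eq_zero_mono (abs_nonneg _) (abs_nonneg _) (hyz i) (hyz j) (hd' i j hij))
  have h2 : Tendsto (fun n => 2 * ‖T (y n)‖) atTop (𝓝 0) := by
    simpa using h1.norm.const_mul 2
  exact squeeze_zero (fun n => orderIntervalNorm_nonneg T (hz n)) hyT h2

/-- If `T` is `S`-L-weakly compact, then it is uniformly small on the parts of the elements of the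
solid hull that lie above a suitable `u`. -/
theorem IsLWeaklyCompactOn.exists_orderIntervalNorm_posPart_sub_le [CompleteSpace E]
    [IsOrderedModule ℝ E] {S : Set E} (hS : Bornology.IsBounded S) {T : E →L[ℝ] Y}
    (hT : IsLWeaklyCompactOn S T) {ε : ℝ} (hε : 0 < ε) :
    ∃ u : E, 0 ≤ u ∧ ∀ x ∈ solidClosure S, orderIntervalNorm T (|x| - u)⁺ ≤ ε := by
  by_contra! H
  choose! X hXS hX using H
  obtain ⟨C, hC⟩ := hS.exists_norm_le
  -- `s n` is the sum of the moduli chosen before stage `n`; the next choice is bad for `u = 4 ^ n •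
  -- s n`.
  let s : ℕ → E := fun n => Nat.rec 0 (fun n s => s + |X ((4 : ℝ) ^ n • s)|) n
  have s_succ : ∀ n, s (n + 1) = s n + |X ((4 : ℝ) ^ n • s n)| := fun n => rfl
  have s_nonneg : ∀ n, 0 ≤ s n := by
    intro n
    induction n with
    | zero => exact le_rfl
    | succ n ih => rw [s_succ]; exact add_nonneg ih (abs_nonneg _)
  have s_mono : Monotone s :=
    monotone_nat_of_le_succ fun n => by rw [s_succ]; exact le_add_of_nonneg_right (abs_nonneg _)
  have hu : ∀ n, 0 ≤ (4 : ℝ) ^ n • s n := fun n => smul_nonneg (by positivity) (s_nonneg n)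
  set x : ℕ → E := fun n => |X ((4 : ℝ) ^ n • s n)| with hx
  have x_nonneg : ∀ n, 0 ≤ x n := fun n => abs_nonneg _
  have x_mem : ∀ n, x n ∈ solidClosure S := fun n =>
    mem_solidClosure_of_abs_le (hXS _ (hu n)) (abs_abs _).le
  have x_large : ∀ n, ε < orderIntervalNorm T (x n - (4 : ℝ) ^ n • s n)⁺ := fun n => hX _ (hu n)
  have x_le : ∀ k n, k < n → x k ≤ s n := fun k n hkn =>
    (le_add_of_nonneg_left (s_nonneg k)).trans ((s_succ k).ge.trans (s_mono hkn))
  have x_norm : ∀ n, ‖x n‖ ≤ C := fun n => by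
    obtain ⟨y, hy, hxy⟩ := x_mem n
    exact (norm_le_norm_of_abs_le_abs hxy).trans (hC y hy)
  have hsum : Summable fun n => (1 / 2 : ℝ) ^ n • x n := by
    refine Summable.of_norm_bounded (summable_geometric_two.mul_right C) fun n => ?_
    rw [norm_smul, Real.norm_of_nonneg (by positivity)]
    exact mul_le_mul_of_nonneg_left (x_norm n) (by positivity)
  set v := ∑' n, (1 / 2 : ℝ) ^ n • x n with hv
  have term_nonneg : ∀ n, 0 ≤ (1 / 2 : ℝ) ^ n • x n := fun n =>
    smul_nonneg (by positivity) (x_nonneg n)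
  have x_le_v : ∀ n, (1 / 2 : ℝ) ^ n • x n ≤ v := fun n =>
    hsum.le_tsum n fun m _ => term_nonneg m
  have v_nonneg : 0 ≤ v := (term_nonneg 0).trans (x_le_v 0)
  let t : ℕ → E := fun n => (1 / 2 : ℝ) ^ n • v
  have t_nonneg : ∀ n, 0 ≤ t n := fun n => smul_nonneg (by positivity) v_nonneg
  -- The first cut handles earlier terms, the second later ones: for `k < n`, `s n` dominates `x k`
  -- and `t k` dominates `2⁻ᵏ2⁻ⁿ • x n`, with `2⁻ᵏ2⁻ⁿ4ⁿ ≥ 1`. The second cut costs at most `‖T‖ * ‖t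
  -- n‖ → 0`.
  let w : ℕ → E := fun n => ((x n - (4 : ℝ) ^ n • s n)⁺ - t n)⁺
  have w_nonneg : ∀ n, 0 ≤ w n := fun n => posPart_nonneg _
  have w_le : ∀ n, w n ≤ (x n - (4 : ℝ) ^ n • s n)⁺ := fun n =>
    posPart_sub_le_self (posPart_nonneg _) (t_nonneg n)
  have w_le' : ∀ n, w n ≤ (x n - t n)⁺ := fun n =>
    posPart_mono (sub_le_sub_right (posPart_sub_le_self (x_nonneg n) (hu n)) _)
  have hlim : Tendsto (fun n => orderIntervalNorm T (w n)) atTop (𝓝 0) := by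
    refine hT.tendsto_orderIntervalNorm w_nonneg
      (fun n => mem_solidClosure_of_nonneg_of_le (x_mem n) (w_nonneg n)
        ((w_le n).trans (posPart_sub_le_self (x_nonneg n) (hu n)))) fun k n hkn => ?_
    refine inf_eq_zero_mono (w_nonneg k) (w_nonneg n)
      ((w_le' k).trans (b := (x k - t k)⁺) (c := (x k - ((1 / 2 : ℝ) ^ k * (1 / 2) ^ n) • x n)⁺)
        (posPart_mono (sub_le_sub_left ?_ _)))
      ((w_le n).trans (c := (x n - (4 : ℝ) ^ n • x k)⁺) (posPart_mono (sub_le_sub_left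
        (smul_le_smul_of_nonneg_left (x_le k n hkn) (by positivity)) _)))
      (posPart_sub_smul_inf_eq_zero (x_nonneg n) (by positivity) ?_)
    · rw [← smul_smul]
      exact smul_le_smul_of_nonneg_left (x_le_v n) (by positivity)
    · have h4 : (4 : ℝ) ^ n = 2 ^ n * 2 ^ n := by rw [← mul_pow]; norm_num
      have h2 : (2 : ℝ) ^ k ≤ 2 ^ n := pow_le_pow_right₀ one_le_two hkn.le
      rw [one_div, inv_pow, inv_pow, h4]
      have : (1 : ℝ) = (2 ^ k)⁻¹ * (2 ^ n)⁻¹ * (2 ^ k * 2 ^ n) := by field_simp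
      rw [this]
      gcongr
  have hlow : ∀ n, ε - ‖T‖ * ‖t n‖ ≤ orderIntervalNorm T (w n) := fun n =>
    (sub_le_sub_right (x_large n).le _).trans
      (orderIntervalNorm_posPart_sub_ge T (posPart_nonneg _) (t_nonneg n))
  have ht : Tendsto t atTop (𝓝 0) := by
    simpa [t] using (tendsto_pow_atTop_nhds_zero_of_lt_one (r := (1 / 2 : ℝ)) (by norm_num)
      (by norm_num)).smul_const v
  have hlim' : Tendsto (fun n => ε - ‖T‖ * ‖t n‖) atTop (𝓝 ε) := by
    simpa using (ht.norm.const_mul ‖T‖).const_sub ε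
  exact hε.not_ge (le_of_tendsto_of_tendsto' hlim' hlim hlow)

end Disjoint

/-! ### Domination by a positive functional on an order interval. -/

section OrderInterval

variable {E : Type*} [NormedAddCommGroup E] [NormedSpace ℝ E] [Lattice E]
  [IsOrderedAddMonoid E] [HasSolidNorm E]
  {Y : Type*} [NormedAddCommGroup Y] [NormedSpace ℝ Y]

/-- On the part of the solid hull of `S` lying in `[0, w]`, no positive functional dominates `T`
up to `e`. -/
def NotDominatedOn (S : Set E) (T : E →L[ℝ] Y) (w : E) (e : ℝ) : Prop :=
  ∀ g : StrongDual ℝ E, (∀ x, 0 ≤ x → 0 ≤ g x) →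
    ∃ x ∈ solidClosure S, 0 ≤ x ∧ x ≤ w ∧ g x + e < orderIntervalNorm T x

/-- Composing `T` with a norming functional recovers additivity, which `ρ_T` lacks. -/
theorem exists_dual_orderIntervalNorm_gt (T : E →L[ℝ] Y) {x : E} (hx : 0 ≤ x) {c : ℝ}
    (h : c < orderIntervalNorm T x) :
    ∃ f : StrongDual ℝ E, c < orderIntervalNorm f x ∧
      ∀ z, 0 ≤ z → orderIntervalNorm f z ≤ orderIntervalNorm T z := by
  obtain ⟨y, hy, hc⟩ := exists_lt_norm_apply T hx h
  obtain ⟨φ, hφ, hφy⟩ := exists_dual_vector'' ℝ (T y)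
  refine ⟨φ.comp T, ?_, fun z hz => ?_⟩
  · refine hc.trans_le (le_trans ?_ (norm_apply_le_orderIntervalNorm (φ.comp T) hy))
    simp [hφy]
  · refine orderIntervalNorm_le _ hz fun y hy =>
      le_trans ?_ (norm_apply_le_orderIntervalNorm T hy)
    exact (φ.le_opNorm _).trans (mul_le_of_le_one_left (norm_nonneg _) hφ)

theorem orderIntervalNorm_eq_add_inf (f : StrongDual ℝ E) {x a : E} (hx : 0 ≤ x) (ha : 0 ≤ a) :
    orderIntervalNorm f x = orderIntervalNorm f (x - a)⁺ + orderIntervalNorm f (x ⊓ a) := by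
  rw [← orderIntervalNorm_add f (posPart_nonneg _) (le_inf hx ha), ← sub_posPart_sub_eq_inf]
  congr 1
  abel

variable [IsOrderedModule ℝ E] {S : Set E} {T : E →L[ℝ] Y}

theorem NotDominatedOn.exists_pairwise_disjoint {w : E} (hw : 0 ≤ w) {e : ℝ}
    (h : NotDominatedOn S T w e) (M : ℕ) {δ : ℝ} (hδ : 0 < δ) :
    ∃ a : ℕ → E, (∀ i < M, a i ∈ solidClosure S ∧ 0 ≤ a i ∧ a i ≤ w ∧
      e - δ < orderIntervalNorm T (a i)) ∧ ∀ j < M, ∀ i < j, a i ⊓ a j = 0 := by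
  induction M generalizing δ with
  | zero => exact ⟨fun _ => 0, by simp, by simp⟩
  | succ M ih =>
    obtain ⟨a, ha, hd⟩ := ih (half_pos hδ)
    have hf : ∀ i, ∃ f : StrongDual ℝ E, i < M → e - δ / 2 < orderIntervalNorm f (a i) ∧
        ∀ z, 0 ≤ z → orderIntervalNorm f z ≤ orderIntervalNorm T z := by
      intro i
      by_cases hi : i < M
      · obtain ⟨f, h1, h2⟩ := exists_dual_orderIntervalNorm_gt T (ha i hi).2.1 (ha i hi).2.2.2
        exact ⟨f, fun _ => ⟨h1, h2⟩⟩
      · exact ⟨0, fun h => absurd h hi⟩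
    choose f hf using hf
    choose G hG using fun i => exists_dual_eq_orderIntervalNorm (f i)
    have hG0 : ∀ i x, 0 ≤ x → 0 ≤ G i x := fun i x hx => by
      rw [hG i x hx]; exact orderIntervalNorm_nonneg _ hx
    set B := ‖T‖ * ‖w‖ with hB
    have hB0 : 0 ≤ B := by positivity
    -- Large enough that removing `t⁻¹ • w` costs less than `δ` in `ρ_T`.
    set t := B / δ + 1 with ht
    have ht0 : 0 < t := by positivity
    have htB : t⁻¹ * B < δ := by
      rw [inv_mul_lt_iff₀ ht0, ht, add_mul, div_mul_cancel₀ _ hδ.ne']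
      linarith
    -- A multiple of the functionals found so far that forces the next element to be small there.
    set c := t * (2 / δ) * (B + |e| + 1) with hc
    have hc0 : 0 ≤ c := by positivity
    obtain ⟨x, hxS, hx0, hxw, hx⟩ := h (c • ∑ i ∈ Finset.range M, G i) (fun x hx => by
      simp only [smul_apply, sum_apply, smul_eq_mul]
      exact mul_nonneg hc0 (Finset.sum_nonneg fun i _ => hG0 i x hx))
    simp only [smul_apply, sum_apply, smul_eq_mul] at hx
    have hxB : orderIntervalNorm T x ≤ B :=
      (orderIntervalNorm_mono T hx0 hxw).trans (orderIntervalNorm_le_opNorm T hw)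
    have hsmall : ∀ i < M, t * orderIntervalNorm (f i) x ≤ δ / 2 := by
      intro i hi
      have h1 : G i x ≤ ∑ i ∈ Finset.range M, G i x :=
        Finset.single_le_sum (f := fun i => G i x) (fun j _ => hG0 j x hx0)
          (Finset.mem_range.2 hi)
      have h2 : c * G i x ≤ B + |e| := by
        have := mul_le_mul_of_nonneg_left h1 hc0
        linarith [neg_abs_le e]
      rw [hG i x hx0] at h2
      by_contra! h3
      have h4 : 0 < B + |e| + 1 := by positivity
      have h5 : c * orderIntervalNorm (f i) x =
          (B + |e| + 1) * (2 / δ * (t * orderIntervalNorm (f i) x)) := by rw [hc]; ring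
      have h6 : 2 / δ * (δ / 2) = 1 := by field_simp
      have h7 : 1 < 2 / δ * (t * orderIntervalNorm (f i) x) :=
        h6.symm.trans_lt (mul_lt_mul_of_pos_left h3 (by positivity))
      have h8 := mul_lt_mul_of_pos_left h7 h4
      linarith
    have htx : 0 ≤ t • x := smul_nonneg ht0.le hx0
    have htw : 0 ≤ t⁻¹ • w := smul_nonneg (by positivity) hw
    -- Old elements lose at most `δ / 2`, since `|f i| (t • x)` is small; as `a i ≤ w`, the
    -- reciprocal factors make them disjoint from the new element.
    refine ⟨fun i => if i < M then (a i - t • x)⁺ else (x - t⁻¹ • w)⁺, ?_, ?_⟩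
    · intro i hi
      by_cases hiM : i < M
      · obtain ⟨h1, h2, h3, -⟩ := ha i hiM
        simp only [hiM, if_true]
        have hle := posPart_sub_le_self h2 htx
        refine ⟨mem_solidClosure_of_nonneg_of_le h1 (posPart_nonneg _) hle, posPart_nonneg _,
          hle.trans h3, ?_⟩
        refine lt_of_lt_of_le ?_ ((hf i hiM).2 _ (posPart_nonneg _))
        have h5 := orderIntervalNorm_eq_add_inf (f i) h2 htx
        have h6 : orderIntervalNorm (f i) (a i ⊓ t • x) ≤ t * orderIntervalNorm (f i) x := by
          refine (orderIntervalNorm_mono _ (le_inf h2 htx) inf_le_right).trans ?_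
          rw [← hG i _ htx, ← hG i _ hx0, map_smul, smul_eq_mul]
        linarith [hsmall i hiM, (hf i hiM).1]
      · simp only [hiM, if_false]
        have hle := posPart_sub_le_self hx0 htw
        refine ⟨mem_solidClosure_of_nonneg_of_le hxS (posPart_nonneg _) hle, posPart_nonneg _,
          hle.trans hxw, ?_⟩
        have h5 := orderIntervalNorm_posPart_sub_ge T hx0 htw
        rw [norm_smul, Real.norm_of_nonneg (by positivity), mul_left_comm] at h5
        have h6 : 0 ≤ c * ∑ i ∈ Finset.range M, G i x :=
          mul_nonneg hc0 (Finset.sum_nonneg fun i _ => hG0 i x hx0)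
        linarith
    · intro j hj i hij
      have hiM : i < M := by omega
      obtain ⟨-, h2, h3, -⟩ := ha i hiM
      by_cases hjM : j < M
      · simp only [hiM, hjM, if_true]
        exact inf_eq_zero_mono (posPart_nonneg _) (posPart_nonneg _)
          (posPart_sub_le_self h2 htx) (posPart_sub_le_self (ha j hjM).2.1 htx) (hd j hjM i hij)
      · simp only [hiM, hjM, if_true, if_false]
        refine inf_eq_zero_mono (posPart_nonneg _) (posPart_nonneg _) le_rfl
          (posPart_mono (sub_le_sub_left (smul_le_smul_of_nonneg_left h3 (by positivity)) x))
          (posPart_sub_smul_inf_eq_zero hx0 (d := t⁻¹) (by positivity) ?_)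
        rw [mul_inv_cancel₀ ht0.ne']

/-- Pigeonhole: take `M > B / δ` disjoint elements `a i`. If each `(w - t • a i)⁺` admitted a
dominating `g i`, then `∑ g i` would dominate on `[0, w]`, because any `x` there has little
`|f|`-mass on some `t • a i`. -/
theorem NotDominatedOn.exists_split {w : E} (hw : 0 ≤ w) {e : ℝ}
    (h : NotDominatedOn S T w e) {δ : ℝ} (hδ : 0 < δ) :
    ∃ z w' : E, z ∈ solidClosure S ∧ 0 ≤ z ∧ z ≤ w ∧ e - δ < orderIntervalNorm T z ∧
      0 ≤ w' ∧ w' ≤ w ∧ z ⊓ w' = 0 ∧ NotDominatedOn S T w' (e - δ) := by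
  set B := ‖T‖ * ‖w‖ with hB
  have hB0 : 0 ≤ B := by positivity
  obtain ⟨M, hM⟩ := exists_nat_gt (B / δ)
  rw [div_lt_iff₀ hδ] at hM
  obtain ⟨a, ha, hd⟩ := h.exists_pairwise_disjoint hw M (half_pos hδ)
  set t := B / (δ / 2) + 1 with ht
  have ht0 : 0 < t := by positivity
  have htB : t⁻¹ * B < δ / 2 := by
    rw [inv_mul_lt_iff₀ ht0, ht, add_mul, div_mul_cancel₀ _ (half_pos hδ).ne']
    linarith
  have hta : ∀ i < M, 0 ≤ t • a i := fun i hi => smul_nonneg ht0.le (ha i hi).2.1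
  suffices hsuff : ∃ i < M, NotDominatedOn S T (w - t • a i)⁺ (e - δ) by
    obtain ⟨i, hi, hnd⟩ := hsuff
    obtain ⟨h1, h2, h3, h4⟩ := ha i hi
    have htw : 0 ≤ t⁻¹ • w := smul_nonneg (by positivity) hw
    have hle := posPart_sub_le_self h2 htw
    refine ⟨(a i - t⁻¹ • w)⁺, (w - t • a i)⁺,
      mem_solidClosure_of_nonneg_of_le h1 (posPart_nonneg _) hle, posPart_nonneg _, hle.trans h3,
      ?_, posPart_nonneg _, posPart_sub_le_self hw (hta i hi), ?_, hnd⟩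
    · have h5 := orderIntervalNorm_posPart_sub_ge T h2 htw
      rw [norm_smul, Real.norm_of_nonneg (by positivity), mul_left_comm] at h5
      linarith
    · exact posPart_sub_smul_inf_eq_zero hw ht0.le (by rw [inv_mul_cancel₀ ht0.ne'])
  by_contra! H
  have hg : ∀ i, ∃ g : StrongDual ℝ E, (∀ x, 0 ≤ x → 0 ≤ g x) ∧ (i < M → ∀ x ∈ solidClosure S,
      0 ≤ x → x ≤ (w - t • a i)⁺ → orderIntervalNorm T x ≤ g x + (e - δ)) := by
    intro i
    by_cases hi : i < M
    · have := H i hi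
      unfold NotDominatedOn at this
      push Not at this
      obtain ⟨g, hg, hg'⟩ := this
      exact ⟨g, hg, fun _ => hg'⟩
    · exact ⟨0, by simp, fun h => absurd h hi⟩
  choose g hg0 hg using hg
  obtain ⟨x, hxS, hx0, hxw, hx⟩ := h (∑ i ∈ Finset.range M, g i) (fun x hx => by
    rw [sum_apply]
    exact Finset.sum_nonneg fun i _ => hg0 i x hx)
  rw [sum_apply] at hx
  obtain ⟨f, hfx, hfle⟩ := exists_dual_orderIntervalNorm_gt T hx0 hx
  have hfB : orderIntervalNorm f x ≤ B :=
    (hfle x hx0).trans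
      ((orderIntervalNorm_mono T hx0 hxw).trans (orderIntervalNorm_le_opNorm T hw))
  have hsum : ∑ i ∈ Finset.range M, orderIntervalNorm f (x ⊓ t • a i) ≤ B := by
    refine (sum_orderIntervalNorm_le f _ (fun i hi => le_inf hx0 (hta i (Finset.mem_range.1 hi)))
      hx0 (fun i _ => inf_le_left) fun i hi j hj hij => ?_).trans hfB
    rw [Finset.mem_range] at hi hj
    have h1 : a i ⊓ a j = 0 := by
      rcases hij.lt_or_gt with h' | h'
      · exact hd j hj i h'
      · rw [inf_comm]; exact hd i hi j h'
    exact inf_eq_zero_mono (le_inf hx0 (hta i hi)) (le_inf hx0 (hta j hj)) inf_le_right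
      inf_le_right (smul_inf_smul_eq_zero (ha i hi).2.1 (ha j hj).2.1 h1 ht0.le ht0.le)
  -- Otherwise the sum would be at least `M * δ > B`.
  obtain ⟨i, hi, hiδ⟩ : ∃ i ∈ Finset.range M, orderIntervalNorm f (x ⊓ t • a i) < δ := by
    by_contra! hge
    have := Finset.card_nsmul_le_sum _ _ _ hge
    rw [Finset.card_range, nsmul_eq_mul] at this
    linarith
  have hiM := Finset.mem_range.1 hi
  have hle := posPart_sub_le_self hx0 (hta i hiM)
  have h1 := hg i hiM (x - t • a i)⁺ (mem_solidClosure_of_nonneg_of_le hxS (posPart_nonneg _) hle)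
    (posPart_nonneg _) (posPart_mono (sub_le_sub_right hxw _))
  have h2 := hfle _ (posPart_nonneg (x - t • a i))
  have h3 := orderIntervalNorm_eq_add_inf f hx0 (hta i hiM)
  have h4 : g i (x - t • a i)⁺ ≤ g i x := by
    rw [← sub_nonneg, ← map_sub]
    exact hg0 i _ (sub_nonneg.2 hle)
  have h5 : g i x ≤ ∑ i ∈ Finset.range M, g i x :=
    Finset.single_le_sum (f := fun i => g i x) (fun j _ => hg0 j x hx0) hi
  linarith

theorem IsLWeaklyCompactOn.not_notDominatedOn (hT : IsLWeaklyCompactOn S T) {u : E}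
    (hu : 0 ≤ u) {ε : ℝ} (hε : 0 < ε) : ¬ NotDominatedOn S T u ε := by
  intro h
  -- The total loss over all splittings stays below `ε / 2`.
  let e : ℕ → ℝ := fun n => ε / 2 + ε / 2 * (1 / 2) ^ n
  have he : ∀ n, ε / 2 < e n := fun n => lt_add_of_pos_right _ (by positivity)
  let P : ℕ → E → Prop := fun n w => 0 ≤ w ∧ NotDominatedOn S T w (e n)
  have step : ∀ n w, P n w → ∃ z w' : E, (z ∈ solidClosure S ∧ 0 ≤ z ∧ z ≤ w ∧
      ε / 2 < orderIntervalNorm T z) ∧ w' ≤ w ∧ z ⊓ w' = 0 ∧ P (n + 1) w' := by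
    rintro n w ⟨hw, hnd⟩
    obtain ⟨z, w', h1, h2, h3, h4, h5, h6, h7, h8⟩ :=
      hnd.exists_split hw (δ := e n - e (n + 1)) (by
        have : 0 < ε / 2 * (1 / 2) ^ n := by positivity
        simp only [e, pow_succ]
        linarith)
    rw [sub_sub_cancel] at h4 h8
    exact ⟨z, w', ⟨h1, h2, h3, (he _).trans h4⟩, h6, h7, h5, h8⟩
  choose! z w' hz hw' hzw' hP using step
  let w : ℕ → E := fun n => Nat.rec u w' n
  have w_succ : ∀ n, w (n + 1) = w' n (w n) := fun n => rfl
  have hPw : ∀ n, P n (w n) := by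
    intro n
    induction n with
    | zero => exact ⟨hu, by rw [show e 0 = ε by simp [e]]; exact h⟩
    | succ n ih => exact hP n _ ih
  have w_anti : Antitone w := antitone_nat_of_succ_le fun n => hw' n _ (hPw n)
  have hlim := hT.tendsto_orderIntervalNorm (z := fun n => z n (w n))
    (fun n => (hz n _ (hPw n)).2.1) (fun n => (hz n _ (hPw n)).1) fun i j hij =>
      inf_eq_zero_mono (hz i _ (hPw i)).2.1 (hz j _ (hPw j)).2.1 le_rfl
        ((hz j _ (hPw j)).2.2.1.trans (w_anti hij)) (hzw' i _ (hPw i))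
  exact (half_pos hε).not_ge (ge_of_tendsto' hlim fun n => (hz n _ (hPw n)).2.2.2.le)

theorem IsLWeaklyCompactOn.exists_norm_apply_le [CompleteSpace E] (hS : Bornology.IsBounded S)
    (hT : IsLWeaklyCompactOn S T) {ε : ℝ} (hε : 0 < ε) :
    ∃ g : StrongDual ℝ E, (∀ x : E, 0 ≤ x → 0 ≤ g x) ∧
      ∃ u : E, 0 ≤ u ∧ ∀ x ∈ solidClosure S, ‖T x‖ ≤ g (|x| ⊓ u) + ε := by
  obtain ⟨u, hu, hu'⟩ := hT.exists_orderIntervalNorm_posPart_sub_le hS (half_pos hε)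
  have h := hT.not_notDominatedOn hu (half_pos hε)
  unfold NotDominatedOn at h
  push Not at h
  obtain ⟨g, hg, hg'⟩ := h
  refine ⟨g, hg, u, hu, fun x hx => ?_⟩
  have h0 : 0 ≤ |x| ⊓ u := le_inf (abs_nonneg _) hu
  have h1 := hg' (|x| ⊓ u) (mem_solidClosure_of_abs_le hx
    (by rw [abs_of_nonneg h0]; exact inf_le_left)) h0 inf_le_right
  have h2 := orderIntervalNorm_add_le T (posPart_nonneg (|x| - u)) h0
  rw [← sub_posPart_sub_eq_inf, add_sub_cancel, sub_posPart_sub_eq_inf] at h2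
  linarith [norm_apply_le_orderIntervalNorm T (le_refl |x|), hu' x hx]

end OrderInterval

/-! ### Nets, and the equivalence. -/

theorem tendsto_zero_of_forall_norm_apply_le {E : Type*} [NormedAddCommGroup E] [NormedSpace ℝ E]
    [Lattice E] {Y : Type*} [NormedAddCommGroup Y] [NormedSpace ℝ Y] {T : E →L[ℝ] Y} {S : Set E}
    (h : ∀ ε : ℝ, 0 < ε → ∃ g : StrongDual ℝ E, (∀ x : E, 0 ≤ x → 0 ≤ g x) ∧
      ∃ u : E, 0 ≤ u ∧ ∀ x ∈ solidClosure S, ‖T x‖ ≤ g (|x| ⊓ u) + ε)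
    {ι : Type*} {l : Filter ι} {x : ι → E} (hxS : ∀ i, x i ∈ solidClosure S)
    (hx : UawTendsto x l 0) : Tendsto (fun i => T (x i)) l (𝓝 0) := by
  rw [Metric.tendsto_nhds]
  intro ε hε
  obtain ⟨g, -, u, hu, hgu⟩ := h (ε / 2) (half_pos hε)
  have h1 := tendsto_toWeakSpace_zero_iff.1 (hx u hu) g
  filter_upwards [h1.eventually_lt_const (half_pos hε)] with i hi
  rw [sub_zero] at hi
  rw [dist_zero_right]
  linarith [hgu (x i) (hxS i)]

/-- `E` is a (real) Banach lattice, `Y` a (real) Banach space, `T` a bounded linear operator and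
`S` a norm bounded subset of `E`. -/
theorem theorem3p4
    {E : Type*} [NormedAddCommGroup E] [NormedSpace ℝ E] [CompleteSpace E]
    [Lattice E] [IsOrderedAddMonoid E] [IsOrderedModule ℝ E] [HasSolidNorm E]
    {Y : Type*} [NormedAddCommGroup Y] [NormedSpace ℝ Y] [CompleteSpace Y]
    (T : E →L[ℝ] Y) (S : Set E) (hS : Bornology.IsBounded S) :
    List.TFAE [
      IsLWeaklyCompactOn S T,
      ∀ ε : ℝ, 0 < ε → ∃ g : StrongDual ℝ E, (∀ x : E, 0 ≤ x → 0 ≤ g x) ∧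
        ∃ u : E, 0 ≤ u ∧ ∀ x ∈ solidClosure S, ‖T x‖ ≤ g (|x| ⊓ u) + ε,
      ∀ (ι : Type*) [Preorder ι] [IsDirectedOrder ι] [Nonempty ι] (x : ι → E),
        (∀ i, x i ∈ solidClosure S) → UawTendsto x atTop 0 →
          Tendsto (fun i => T (x i)) atTop (𝓝 0)] := by
  tfae_have 1 → 2 := fun hT ε hε => hT.exists_norm_apply_le hS hε
  tfae_have 2 → 3 := fun h ι _ _ _ x hxS hx => tendsto_zero_of_forall_norm_apply_le h hxS hx
  tfae_have 3 → 1 := by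
    intro h x hxS hx
    -- Index types range over an arbitrary universe, so a sequence is viewed as a net over `ULift
    -- ℕ`.
    have hdown : Tendsto (ULift.down : ULift ℕ → ℕ) atTop atTop :=
      tendsto_atTop_atTop.2 fun b => ⟨⟨b⟩, fun _ h => h⟩
    have hup : Tendsto (ULift.up : ℕ → ULift ℕ) atTop atTop :=
      tendsto_atTop_atTop.2 fun b => ⟨b.down, fun _ h => h⟩
    exact (h (ULift ℕ) (fun i => x i.down) (fun i => hxS _)
      fun u hu => (hx u hu).comp hdown).comp hup
  tfae_finish
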